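/- For a positive integer $n$ let $\Omega(n)$ denote the number of prime factors of $n$ counted with multiplicity. Let $\alpha \geq 1$ be a real number. Then, as the real variable $X$ tends to infinity, \[ \sum_{1\le n\leq X} \Omega(n)^\alpha = X (\log\log X)^\alpha + O\left( X (\log\log X)^{\alpha-1} \right), \] where the implied constant may depend on $\alpha$. In particular, $\Omega(n)^\alpha$ has average order $(\log\log n)^\alpha$, in the sense that \[ \frac1X \sum_{1\le n\leq X} \Omega(n)^\alpha \asymp (\log\log X)^\alpha \qquad (X\to\infty), \] that is, for all sufficiently large $X$ each side is at most a constant (depending only on $\alpha$) times the other. -/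

import Mathlib

/-- The arithmetic function `f` has average order `g`:
`(1 / X) * ∑_{1 ≤ n ≤ X} f n ≍ g X` as the real variable `X` tends to infinity. -/
def HasAverageOrder (f : ℕ → ℝ) (g : ℝ → ℝ) : Prop :=
  (fun X : ℝ => (1 / X) * ∑ n ∈ Finset.Icc 1 ⌊X⌋₊, f n) =Θ[Filter.atTop] g

/-! Write P(N) for `primeRecipSum N`. Mertens' estimate P(N) = log log N + O(1) comes from Euler
products (`primeRecipSum_le`, `exists_loglog_le_primeRecipSum`). Upper bound: expanding one factor
Ω(n) of Ω(n)^(k+1) over prime powers p^j ∣ n and writing n = p^j m reduces the moment to sums of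
(Ω(m) + j)^k over m ≤ M/p^j. Induction gives integer moments at most M (P(N) + C)^k
(`exists_sum_cardFactors_pow_le`), and the power mean inequality passes from k = ⌈α⌉ down to α.
Lower bound: the power mean inequality reduces to the first moment, where the primes alone suffice
(`le_sum_cardFactors`). Both bounds are (log log X + O(1))^α, which expands with error O((log log
X)^(α-1)). -/

/-- The sum of the reciprocals of the primes `p ≤ N`. -/
noncomputable def primeRecipSum (N : ℕ) : ℝ := ∑ p ∈ (N + 1).primesBelow, 1 / (p : ℝ)

lemma primeRecipSum_nonneg (N : ℕ) : 0 ≤ primeRecipSum N :=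
  Finset.sum_nonneg fun _ _ => by positivity

/-! ### Chebyshev-type bound for the sum of log p / p -/

lemma card_filter_dvd_Icc (M d : ℕ) : ((Finset.Icc 1 M).filter (d ∣ ·)).card = M / d :=
  Nat.Ioc_filter_dvd_card_eq_div M d

lemma sum_log_primeFactors_le_log {n : ℕ} (hn : n ≠ 0) :
    ∑ p ∈ n.primeFactors, Real.log p ≤ Real.log n := by
  rw [← Real.log_prod fun p hp => Nat.cast_ne_zero.mpr (Nat.prime_of_mem_primeFactors hp).ne_zero]
  have h := Nat.le_of_dvd (Nat.pos_of_ne_zero hn) (Nat.prod_primeFactors_dvd n)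
  refine Real.log_le_log ?_ (by rw [← Nat.cast_prod]; exact_mod_cast h)
  exact Finset.prod_pos fun p hp => by exact_mod_cast (Nat.prime_of_mem_primeFactors hp).pos

lemma half_div_le_nat_div {N p : ℕ} (hp : 0 < p) (hpN : p ≤ N) :
    (N : ℝ) / (2 * p) ≤ ((N / p : ℕ) : ℝ) := by
  have h1 : 1 ≤ N / p := (Nat.one_le_div_iff hp).mpr hpN
  have h2 : N ≤ 2 * p * (N / p) := by
    have := Nat.lt_div_mul_add (a := N) hp
    nlinarith
  have h2' : (N : ℝ) ≤ 2 * p * ((N / p : ℕ) : ℝ) := by exact_mod_cast h2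
  rw [div_le_iff₀ (by positivity)]
  linarith

/-- Double counting of the pairs p ∣ n ≤ N with weight log p; the factor 2 pays for the floor in N /
p. -/
lemma sum_log_div_prime_le (N : ℕ) :
    ∑ p ∈ (N + 1).primesBelow, Real.log p / p ≤ 2 * Real.log N := by
  rcases Nat.eq_zero_or_pos N with rfl | hN
  · simp [Nat.primesBelow, Finset.sum_filter]
  have hN' : (0 : ℝ) < N := by exact_mod_cast hN
  have key : ∑ p ∈ (N + 1).primesBelow, Real.log p * ((N / p : ℕ) : ℝ) ≤ N * Real.log N := by
    calc ∑ p ∈ (N + 1).primesBelow, Real.log p * ((N / p : ℕ) : ℝ)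
        = ∑ p ∈ (N + 1).primesBelow, ∑ n ∈ Finset.Icc 1 N,
            if p ∣ n then Real.log p else 0 := by
          refine Finset.sum_congr rfl fun p _ => ?_
          rw [← Finset.sum_filter, Finset.sum_const, card_filter_dvd_Icc, nsmul_eq_mul, mul_comm]
      _ = ∑ n ∈ Finset.Icc 1 N, ∑ p ∈ (N + 1).primesBelow,
            if p ∣ n then Real.log p else 0 := Finset.sum_comm
      _ ≤ ∑ n ∈ Finset.Icc 1 N, Real.log N := by
          refine Finset.sum_le_sum fun n hn => ?_
          obtain ⟨h1, h2⟩ := Finset.mem_Icc.mp hn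
          rw [← Finset.sum_filter]
          have h3 : ((N + 1).primesBelow.filter (· ∣ n)) = n.primeFactors := by
            ext p
            simp only [Finset.mem_filter, Nat.mem_primesBelow, Nat.mem_primeFactors]
            constructor
            · rintro ⟨⟨_, hp⟩, hd⟩
              exact ⟨hp, hd, by lia⟩
            · rintro ⟨hp, hd, _⟩
              have := Nat.le_of_dvd (by lia) hd
              exact ⟨⟨by lia, hp⟩, hd⟩
          rw [h3]
          refine (sum_log_primeFactors_le_log (by lia)).trans ?_
          exact Real.log_le_log (by exact_mod_cast h1) (by exact_mod_cast h2)
      _ = N * Real.log N := by simp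
  have h2 : N / 2 * ∑ p ∈ (N + 1).primesBelow, Real.log p / p ≤
      ∑ p ∈ (N + 1).primesBelow, Real.log p * ((N / p : ℕ) : ℝ) := by
    rw [Finset.mul_sum]
    refine Finset.sum_le_sum fun p hp => ?_
    obtain ⟨h1, h2⟩ := Nat.mem_primesBelow.mp hp
    have h3 := half_div_le_nat_div h2.pos (by lia : p ≤ N)
    have h4 : 0 ≤ Real.log p := Real.log_natCast_nonneg p
    calc (N : ℝ) / 2 * (Real.log p / p) = Real.log p * (N / (2 * p)) := by ring
      _ ≤ _ := mul_le_mul_of_nonneg_left h3 h4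
  have h3 := h2.trans key
  have h4 : (N : ℝ) * (∑ p ∈ (N + 1).primesBelow, Real.log p / p) ≤ N * (2 * Real.log N) := by
    linarith
  exact le_of_mul_le_mul_left h4 hN'

/-! ### Euler products and Mertens' estimate -/

/-- The completely multiplicative function `n ↦ n ^ (-s)`. -/
noncomputable def negRpowHom (s : ℝ) : ℕ →* ℝ where
  toFun n := (n : ℝ) ^ (-s)
  map_one' := by simp
  map_mul' m n := by
    push_cast
    exact Real.mul_rpow (by positivity) (by positivity)

lemma negRpowHom_apply (s : ℝ) (n : ℕ) : negRpowHom s n = (n : ℝ) ^ (-s) := rfl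

lemma negRpowHom_nonneg (s : ℝ) (n : ℕ) : 0 ≤ negRpowHom s n :=
  Real.rpow_nonneg (by positivity) _

lemma negRpowHom_prime_le_half {s : ℝ} (hs : 1 ≤ s) {p : ℕ} (hp : p.Prime) :
    negRpowHom s p ≤ 1 / 2 := by
  have h2 : (2 : ℝ) ≤ p := by exact_mod_cast hp.two_le
  calc (p : ℝ) ^ (-s) ≤ (p : ℝ) ^ (-1 : ℝ) :=
        Real.rpow_le_rpow_of_exponent_le (by linarith) (by linarith)
    _ = 1 / p := by rw [Real.rpow_neg_one, one_div]
    _ ≤ 1 / 2 := one_div_le_one_div_of_le (by norm_num) h2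

lemma log_prod_one_sub_inv {s : ℝ} (hs : 1 ≤ s) (N : ℕ) :
    Real.log (∏ p ∈ N.primesBelow, (1 - negRpowHom s p)⁻¹) =
      ∑ p ∈ N.primesBelow, -Real.log (1 - negRpowHom s p) := by
  rw [Real.log_prod]
  · exact Finset.sum_congr rfl fun p _ => Real.log_inv _
  · intro p hp
    have := negRpowHom_prime_le_half hs (Nat.prime_of_mem_primesBelow hp)
    exact inv_ne_zero (by linarith)

lemma tsum_negRpowHom_le {s : ℝ} (hs : 1 < s) :
    Summable (negRpowHom s) ∧ ∑' n, negRpowHom s n ≤ 1 + 1 / (s - 1) := by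
  have hsum : Summable (negRpowHom s) := by
    exact (Real.summable_nat_rpow (p := -s)).mpr (by linarith)
  refine ⟨hsum, ?_⟩
  -- This is ζ(s) - 1/(s-1) = 1 - s * `termTSum s`, with a nonnegative `termTSum`.
  have h1 := ZetaAsymptotics.zeta_limit_aux1 hs
  have h2 : 0 ≤ ZetaAsymptotics.termTSum s := tsum_nonneg fun n => ZetaAsymptotics.term_nonneg _ _
  have h3 : 0 ≤ s * ZetaAsymptotics.termTSum s := mul_nonneg (by linarith) h2
  rw [hsum.tsum_eq_zero_add]
  have h4 : negRpowHom s 0 = 0 := by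
    rw [negRpowHom_apply, Nat.cast_zero, Real.zero_rpow (by linarith)]
  have h5 : ∀ n : ℕ, negRpowHom s (n + 1) = 1 / ((n : ℝ) + 1) ^ s := fun n => by
    rw [negRpowHom_apply, Real.rpow_neg (by positivity), one_div]
    push_cast
    rfl
  simp only [h4, h5]
  linarith

lemma sum_prime_negRpowHom_le {s : ℝ} (hs : 1 < s) (N : ℕ) :
    ∑ p ∈ N.primesBelow, negRpowHom s p ≤ Real.log (1 + 1 / (s - 1)) := by
  obtain ⟨hsum, hle⟩ := tsum_negRpowHom_le hs
  have h1 : ∏ p ∈ N.primesBelow, (1 - negRpowHom s p)⁻¹ ≤ 1 + 1 / (s - 1) := by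
    rw [EulerProduct.prod_primesBelow_geometric_eq_tsum_smoothNumbers hsum N]
    exact (hsum.tsum_subtype_le _ _ (negRpowHom_nonneg s)).trans hle
  have h2 : 0 < ∏ p ∈ N.primesBelow, (1 - negRpowHom s p)⁻¹ := Finset.prod_pos fun p hp => by
    have := negRpowHom_prime_le_half hs.le (Nat.prime_of_mem_primesBelow hp)
    exact inv_pos.mpr (by linarith)
  have h3 := Real.log_le_log h2 h1
  rw [log_prod_one_sub_inv hs.le] at h3
  refine (Finset.sum_le_sum fun p hp => ?_).trans h3
  have := negRpowHom_prime_le_half hs.le (Nat.prime_of_mem_primesBelow hp)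
  have := Real.log_le_sub_one_of_pos (show 0 < 1 - negRpowHom s p by linarith)
  linarith

/-- Rankin's trick: at s = 1 + 1/log N the Euler product bounds the sum of p^(-s), and 1/p - p^(-s)
≤ log p / (p log N) makes the change of exponent cost at most 2. -/
lemma primeRecipSum_le {N : ℕ} (hN : 3 ≤ N) :
    primeRecipSum N ≤ Real.log (Real.log N) + 3 := by
  have hN3 : (3 : ℝ) ≤ N := by exact_mod_cast hN
  have hlog : 1 ≤ Real.log N := by
    rw [Real.le_log_iff_exp_le (by linarith)]
    linarith [Real.exp_one_lt_d9]
  have hs : 1 < 1 + 1 / Real.log N := by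
    have : 0 < 1 / Real.log N := by positivity
    linarith
  have h1 := sum_prime_negRpowHom_le hs (N + 1)
  have h2 : Real.log (1 + 1 / (1 + 1 / Real.log N - 1)) ≤ 1 + Real.log (Real.log N) := by
    rw [add_sub_cancel_left, one_div_one_div]
    calc Real.log (1 + Real.log N) ≤ Real.log (2 * Real.log N) :=
          Real.log_le_log (by linarith) (by linarith)
      _ = Real.log 2 + Real.log (Real.log N) := Real.log_mul (by norm_num) (by linarith)
      _ ≤ _ := by linarith [Real.log_two_lt_d9]
  have h3 : primeRecipSum N - ∑ p ∈ (N + 1).primesBelow, negRpowHom (1 + 1 / Real.log N) p ≤ 2 := by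
    rw [primeRecipSum, ← Finset.sum_sub_distrib]
    calc ∑ p ∈ (N + 1).primesBelow, (1 / (p : ℝ) - negRpowHom (1 + 1 / Real.log N) p)
        ≤ ∑ p ∈ (N + 1).primesBelow, 1 / Real.log N * (Real.log p / p) := by
          refine Finset.sum_le_sum fun p hp => ?_
          have hp0 : (0 : ℝ) < p := by exact_mod_cast (Nat.prime_of_mem_primesBelow hp).pos
          rw [negRpowHom_apply, neg_add, Real.rpow_add hp0, Real.rpow_neg_one,
            Real.rpow_def_of_pos hp0]
          have := Real.add_one_le_exp (Real.log p * -(1 / Real.log N))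
          have h4 := mul_le_mul_of_nonneg_left this (inv_nonneg.mpr hp0.le)
          calc 1 / (p : ℝ) - (p : ℝ)⁻¹ * Real.exp (Real.log p * -(1 / Real.log N))
              ≤ 1 / (p : ℝ) - (p : ℝ)⁻¹ * (Real.log p * -(1 / Real.log N) + 1) := by linarith
            _ = _ := by ring
      _ = 1 / Real.log N * ∑ p ∈ (N + 1).primesBelow, Real.log p / p := by rw [Finset.mul_sum]
      _ ≤ 1 / Real.log N * (2 * Real.log N) :=
          mul_le_mul_of_nonneg_left (sum_log_div_prime_le N) (by positivity)
      _ = 2 := by field_simp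
  linarith

/-- The product expands into the sum of 1/n over N-smooth n, which include all n ≤ N. -/
lemma harmonic_le_prod_one_sub_inv (N : ℕ) :
    (harmonic N : ℝ) ≤ ∏ p ∈ (N + 1).primesBelow, (1 - negRpowHom 1 p)⁻¹ := by
  have h := EulerProduct.summable_and_hasSum_smoothNumbers_prod_primesBelow_geometric
    (f := negRpowHom 1) (fun {p} hp => by
      rw [Real.norm_of_nonneg (negRpowHom_nonneg 1 p)]
      linarith [negRpowHom_prime_le_half le_rfl hp]) (N + 1)
  have hmem : ∀ n ∈ Finset.Icc 1 N, n ∈ (N + 1).smoothNumbers := fun n hn => by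
    obtain ⟨h1, h2⟩ := Finset.mem_Icc.mp hn
    exact Nat.mem_smoothNumbers_of_lt h1 (by lia)
  rw [harmonic_eq_sum_Icc]
  push_cast
  have h5 := sum_le_hasSum ((Finset.Icc 1 N).subtype (· ∈ (N + 1).smoothNumbers))
    (fun i _ => negRpowHom_nonneg 1 i) h.2
  rw [Finset.sum_subtype_of_mem (fun n : ℕ => negRpowHom 1 n) hmem] at h5
  simpa [negRpowHom_apply, Real.rpow_neg_one] using h5

lemma exists_loglog_le_primeRecipSum :
    ∃ C : ℝ, 0 ≤ C ∧ ∀ N : ℕ, 1 ≤ N →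
      Real.log (Real.log (N + 1)) ≤ primeRecipSum N + C := by
  have hsq : Summable fun n : ℕ => 2 * (1 / (n : ℝ) ^ 2) :=
    (Real.summable_one_div_nat_pow.mpr one_lt_two).mul_left 2
  refine ⟨∑' n : ℕ, 2 * (1 / (n : ℝ) ^ 2), tsum_nonneg fun n => by positivity, fun N hN => ?_⟩
  have h1 : Real.log (N + 1) ≤ ∏ p ∈ (N + 1).primesBelow, (1 - negRpowHom 1 p)⁻¹ := by
    have := log_add_one_le_harmonic N
    push_cast at this
    exact this.trans (harmonic_le_prod_one_sub_inv N)
  have hN1 : (1 : ℝ) ≤ N := by exact_mod_cast hN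
  have h2 := Real.log_le_log (Real.log_pos (by linarith)) h1
  rw [log_prod_one_sub_inv le_rfl] at h2
  refine h2.trans ?_
  calc ∑ p ∈ (N + 1).primesBelow, -Real.log (1 - negRpowHom 1 p)
      ≤ ∑ p ∈ (N + 1).primesBelow, (1 / (p : ℝ) + 2 * (1 / (p : ℝ) ^ 2)) := by
        refine Finset.sum_le_sum fun p hp => ?_
        have hx := negRpowHom_prime_le_half le_rfl (Nat.prime_of_mem_primesBelow hp)
        have hx0 := negRpowHom_nonneg 1 p
        have hxe : negRpowHom 1 p = 1 / p := by
          rw [negRpowHom_apply, Real.rpow_neg_one, one_div]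
        have hxe2 : 1 / (p : ℝ) ^ 2 = negRpowHom 1 p ^ 2 := by rw [hxe]; ring
        rw [hxe2, ← hxe]
        generalize negRpowHom 1 p = x at hx hx0
        have h3 := Real.one_sub_inv_le_log_of_pos (show 0 < 1 - x by linarith)
        have h4 : (1 - x)⁻¹ ≤ 1 + x + 2 * x ^ 2 := by
          rw [inv_le_iff_one_le_mul₀ (by linarith)]
          -- (1 - x)(1 + x + 2x²) = 1 + x²(1 - 2x).
          nlinarith [mul_nonneg (sq_nonneg x) (show 0 ≤ 1 - 2 * x by linarith)]
        linarith
    _ = primeRecipSum N + ∑ p ∈ (N + 1).primesBelow, 2 * (1 / (p : ℝ) ^ 2) := by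
        rw [Finset.sum_add_distrib, primeRecipSum]
    _ ≤ _ := by
        gcongr
        exact hsq.sum_le_tsum _ fun n _ => by positivity

/-! ### Expansion of Ω over prime powers -/

open ArithmeticFunction in
lemma cardFactors_eq_sum_prime_pow {n N : ℕ} (h1 : 1 ≤ n) (hN : n ≤ N) :
    (cardFactors n : ℝ) = ∑ p ∈ (N + 1).primesBelow, ∑ j ∈ Finset.Ico 1 (N + 1),
      if p ^ j ∣ n then (1 : ℝ) else 0 := by
  have h2 : cardFactors n = ∑ p ∈ (N + 1).primesBelow, n.factorization p := by
    rw [cardFactors_eq_sum_factorization, Finsupp.sum]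
    refine Finset.sum_subset (fun p hp => ?_) fun p _ hp => Finsupp.notMem_support_iff.mp hp
    rw [Nat.support_factorization] at hp
    have := Nat.le_of_mem_primeFactors hp
    exact Nat.mem_primesBelow.mpr ⟨by lia, Nat.prime_of_mem_primeFactors hp⟩
  rw [h2, Nat.cast_sum]
  refine Finset.sum_congr rfl fun p hp => ?_
  have hp' := Nat.prime_of_mem_primesBelow hp
  have h3 : n < p ^ (N + 1) :=
    (by lia : n < N + 1).trans (Nat.lt_pow_self hp'.one_lt)
  rw [Nat.factorization_eq_card_pow_dvd_of_lt hp' h1 h3, Finset.sum_boole]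

lemma sum_Icc_ite_dvd (f : ℕ → ℝ) (M : ℕ) {d : ℕ} (hd : 0 < d) :
    (∑ n ∈ Finset.Icc 1 M, if d ∣ n then f n else 0) =
      ∑ m ∈ Finset.Icc 1 (M / d), f (d * m) := by
  rw [← Finset.sum_filter]
  symm
  refine Finset.sum_bij (fun m _ => d * m) ?_ ?_ ?_ fun _ _ => rfl
  · intro m hm
    obtain ⟨h1, h2⟩ := Finset.mem_Icc.mp hm
    refine Finset.mem_filter.mpr ⟨Finset.mem_Icc.mpr ⟨Nat.mul_pos hd h1, ?_⟩, dvd_mul_right _ _⟩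
    rw [mul_comm]
    exact (Nat.le_div_iff_mul_le hd).mp h2
  · intro a _ b _ h
    exact Nat.eq_of_mul_eq_mul_left hd h
  · intro n hn
    obtain ⟨h1, m, rfl⟩ := Finset.mem_filter.mp hn
    obtain ⟨h2, h3⟩ := Finset.mem_Icc.mp h1
    refine ⟨m, Finset.mem_Icc.mpr ⟨Nat.pos_of_mul_pos_left h2, ?_⟩, rfl⟩
    rw [Nat.le_div_iff_mul_le hd, mul_comm]
    exact h3

open ArithmeticFunction in
lemma sum_mul_cardFactors (f : ℕ → ℝ) {M N : ℕ} (hMN : M ≤ N) :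
    ∑ n ∈ Finset.Icc 1 M, f n * (cardFactors n : ℝ) =
      ∑ p ∈ (N + 1).primesBelow, ∑ j ∈ Finset.Ico 1 (N + 1),
        ∑ m ∈ Finset.Icc 1 (M / p ^ j), f (p ^ j * m) := by
  calc ∑ n ∈ Finset.Icc 1 M, f n * (cardFactors n : ℝ)
      = ∑ n ∈ Finset.Icc 1 M, ∑ p ∈ (N + 1).primesBelow, ∑ j ∈ Finset.Ico 1 (N + 1),
          if p ^ j ∣ n then f n else 0 := by
        refine Finset.sum_congr rfl fun n hn => ?_
        obtain ⟨h1, h2⟩ := Finset.mem_Icc.mp hn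
        rw [cardFactors_eq_sum_prime_pow h1 (h2.trans hMN)]
        simp only [Finset.mul_sum, mul_ite, mul_one, mul_zero]
    _ = ∑ p ∈ (N + 1).primesBelow, ∑ j ∈ Finset.Ico 1 (N + 1), ∑ n ∈ Finset.Icc 1 M,
          if p ^ j ∣ n then f n else 0 := by
        rw [Finset.sum_comm]
        exact Finset.sum_congr rfl fun p _ => Finset.sum_comm
    _ = _ := by
        refine Finset.sum_congr rfl fun p hp => Finset.sum_congr rfl fun j _ => ?_
        exact sum_Icc_ite_dvd f M (pow_pos (Nat.prime_of_mem_primesBelow hp).pos j)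

/-- Only j = 1 contributes a divergent sum over p; for j ≥ 2, p^(-j) ≤ 4 · 2^(-j) · p^(-2) is
summable over both p and j, even with weight j^k. -/
lemma pow_div_pow_le (k : ℕ) {p j : ℕ} (hp : 2 ≤ p) (hj : 1 ≤ j) :
    (j : ℝ) ^ k / (p : ℝ) ^ j ≤
      (if j = 1 then 1 / (p : ℝ) else 0) + 4 * ((j : ℝ) ^ k * (1 / 2) ^ j) * (1 / (p : ℝ) ^ 2) := by
  rcases hj.eq_or_lt with rfl | hj
  · simp only [if_true, Nat.cast_one, one_pow, pow_one]
    have : (0 : ℝ) ≤ 4 * (1 * (1 / 2)) * (1 / (p : ℝ) ^ 2) := by positivity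
    linarith
  · obtain ⟨i, rfl⟩ := Nat.exists_eq_add_of_le (show 2 ≤ j by lia)
    have hp' : (2 : ℝ) ≤ p := by exact_mod_cast hp
    rw [if_neg (by lia), zero_add]
    have h1 : (2 : ℝ) ^ i ≤ (p : ℝ) ^ i := pow_le_pow_left₀ (by norm_num) hp' i
    calc ((2 + i : ℕ) : ℝ) ^ k / (p : ℝ) ^ (2 + i)
        = ((2 + i : ℕ) : ℝ) ^ k * (1 / (p : ℝ) ^ i) * (1 / (p : ℝ) ^ 2) := by
          rw [pow_add]; field_simp
      _ ≤ ((2 + i : ℕ) : ℝ) ^ k * (1 / (2 : ℝ) ^ i) * (1 / (p : ℝ) ^ 2) := by gcongr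
      _ = _ := by rw [pow_add (1 / 2 : ℝ), one_div_pow (2 : ℝ) i]; ring

lemma exists_sum_prime_pow_le (k : ℕ) : ∃ E : ℝ, 0 ≤ E ∧ ∀ N : ℕ,
    ∑ p ∈ (N + 1).primesBelow, ∑ j ∈ Finset.Ico 1 (N + 1), (j : ℝ) ^ k / (p : ℝ) ^ j ≤
      primeRecipSum N + E := by
  have hD : Summable fun j : ℕ => (j : ℝ) ^ k * (1 / 2 : ℝ) ^ j :=
    summable_pow_mul_geometric_of_norm_lt_one k (by norm_num)
  have hZ : Summable fun n : ℕ => 1 / (n : ℝ) ^ 2 := Real.summable_one_div_nat_pow.mpr one_lt_two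
  have hD0 : 0 ≤ ∑' j : ℕ, (j : ℝ) ^ k * (1 / 2 : ℝ) ^ j := tsum_nonneg fun j => by positivity
  have hZ0 : 0 ≤ ∑' n : ℕ, 1 / (n : ℝ) ^ 2 := tsum_nonneg fun j => by positivity
  refine ⟨4 * (∑' j : ℕ, (j : ℝ) ^ k * (1 / 2 : ℝ) ^ j) * ∑' n : ℕ, 1 / (n : ℝ) ^ 2,
    by positivity, fun N => ?_⟩
  calc ∑ p ∈ (N + 1).primesBelow, ∑ j ∈ Finset.Ico 1 (N + 1), (j : ℝ) ^ k / (p : ℝ) ^ j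
      ≤ ∑ p ∈ (N + 1).primesBelow, (1 / (p : ℝ) +
          4 * (∑' j : ℕ, (j : ℝ) ^ k * (1 / 2 : ℝ) ^ j) * (1 / (p : ℝ) ^ 2)) := by
        refine Finset.sum_le_sum fun p hp => ?_
        have hp2 := (Nat.prime_of_mem_primesBelow hp).two_le
        refine (Finset.sum_le_sum fun j hj =>
          pow_div_pow_le k hp2 (Finset.mem_Ico.mp hj).1).trans ?_
        rw [Finset.sum_add_distrib, ← Finset.sum_mul, ← Finset.mul_sum]
        gcongr
        · rw [Finset.sum_ite_eq']
          split_ifs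
          · exact le_rfl
          · positivity
        · exact hD.sum_le_tsum _ fun j _ => by positivity
    _ = primeRecipSum N + 4 * (∑' j : ℕ, (j : ℝ) ^ k * (1 / 2 : ℝ) ^ j) *
          ∑ p ∈ (N + 1).primesBelow, 1 / (p : ℝ) ^ 2 := by
        rw [Finset.sum_add_distrib, ← Finset.mul_sum, primeRecipSum]
    _ ≤ _ := by
        gcongr
        exact hZ.sum_le_tsum _ fun j _ => by positivity

/-! ### Integer moments -/

lemma sum_add_pow_le {ι : Type*} {s : Finset ι} {f : ι → ℝ} {A B x : ℝ} {k : ℕ} (hx : 0 ≤ x)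
    (h : ∀ i ≤ k, ∑ m ∈ s, f m ^ i ≤ B * A ^ i) :
    ∑ m ∈ s, (f m + x) ^ k ≤ B * (A + x) ^ k := by
  simp only [add_pow]
  rw [Finset.sum_comm, Finset.mul_sum]
  refine Finset.sum_le_sum fun i hi => ?_
  rw [← Finset.sum_mul, ← Finset.sum_mul]
  have h1 := h i (by have := Finset.mem_range.mp hi; lia)
  calc (∑ m ∈ s, f m ^ i) * x ^ (k - i) * (k.choose i : ℝ)
      ≤ B * A ^ i * x ^ (k - i) * (k.choose i : ℝ) := by gcongr
    _ = _ := by ring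

open ArithmeticFunction in
lemma sum_cardFactors_pow_succ_le {k M N : ℕ} {A E : ℝ} (hA : 0 ≤ A) (hMN : M ≤ N)
    (hE : ∑ p ∈ (N + 1).primesBelow, ∑ j ∈ Finset.Ico 1 (N + 1), (j : ℝ) ^ k / (p : ℝ) ^ j ≤ E)
    (h : ∀ M' ≤ M, ∀ i ≤ k, ∑ n ∈ Finset.Icc 1 M', (cardFactors n : ℝ) ^ i ≤ M' * A ^ i) :
    ∑ n ∈ Finset.Icc 1 M, (cardFactors n : ℝ) ^ (k + 1) ≤ M * ((A + 1) ^ k * E) := by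
  simp only [pow_succ]
  rw [sum_mul_cardFactors _ hMN]
  calc ∑ p ∈ (N + 1).primesBelow, ∑ j ∈ Finset.Ico 1 (N + 1),
        ∑ m ∈ Finset.Icc 1 (M / p ^ j), (cardFactors (p ^ j * m) : ℝ) ^ k
      ≤ ∑ p ∈ (N + 1).primesBelow, ∑ j ∈ Finset.Ico 1 (N + 1),
          M * (A + 1) ^ k * ((j : ℝ) ^ k / (p : ℝ) ^ j) := by
        refine Finset.sum_le_sum fun p hp => Finset.sum_le_sum fun j hj => ?_
        have hp' := Nat.prime_of_mem_primesBelow hp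
        have hj1 : (1 : ℝ) ≤ j := by exact_mod_cast (Finset.mem_Ico.mp hj).1
        have h1 : ∑ m ∈ Finset.Icc 1 (M / p ^ j), (cardFactors (p ^ j * m) : ℝ) ^ k =
            ∑ m ∈ Finset.Icc 1 (M / p ^ j), ((cardFactors m : ℝ) + j) ^ k := by
          refine Finset.sum_congr rfl fun m hm => ?_
          have hm0 : m ≠ 0 := by have := (Finset.mem_Icc.mp hm).1; lia
          rw [cardFactors_mul (pow_ne_zero _ hp'.ne_zero) hm0, cardFactors_apply_prime_pow hp']
          push_cast
          ring
        rw [h1]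
        have h2 : ((M / p ^ j : ℕ) : ℝ) ≤ M / (p : ℝ) ^ j := by
          have := Nat.cast_div_le (α := ℝ) (m := M) (n := p ^ j)
          push_cast at this
          exact this
        -- Makes the dependence on j multiplicative, so that the sum over p^j factors out.
        have h3 : A + j ≤ (A + 1) * j := by nlinarith
        calc ∑ m ∈ Finset.Icc 1 (M / p ^ j), ((cardFactors m : ℝ) + j) ^ k
            ≤ ((M / p ^ j : ℕ) : ℝ) * (A + j) ^ k :=
              sum_add_pow_le (by positivity) (h _ (Nat.div_le_self _ _))
          _ ≤ M / (p : ℝ) ^ j * ((A + 1) * j) ^ k := by gcongr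
          _ = _ := by rw [mul_pow]; ring
    _ = M * (A + 1) ^ k * ∑ p ∈ (N + 1).primesBelow, ∑ j ∈ Finset.Ico 1 (N + 1),
          (j : ℝ) ^ k / (p : ℝ) ^ j := by simp only [Finset.mul_sum]
    _ ≤ M * (A + 1) ^ k * E := by gcongr
    _ = _ := by ring

-- The induction applies the bound at M / p^j, hence the uniformity in M ≤ N with P(N) fixed; the
-- binomial expansion of (Ω(m) + j)^k needs all exponents i ≤ k.
open ArithmeticFunction in
lemma exists_sum_cardFactors_pow_le (k : ℕ) : ∃ C : ℝ, 0 ≤ C ∧ ∀ N M : ℕ, M ≤ N → ∀ i ≤ k,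
    ∑ n ∈ Finset.Icc 1 M, (cardFactors n : ℝ) ^ i ≤ M * (primeRecipSum N + C) ^ i := by
  induction k with
  | zero =>
    refine ⟨0, le_rfl, fun N M _ i hi => ?_⟩
    obtain rfl : i = 0 := by lia
    simp
  | succ k ih =>
    obtain ⟨C, hC, h⟩ := ih
    obtain ⟨E, hE, hE'⟩ := exists_sum_prime_pow_le k
    refine ⟨C + 1 + E, by positivity, fun N M hMN i hi => ?_⟩
    have hH := primeRecipSum_nonneg N
    rcases hi.eq_or_lt with rfl | hi
    · refine (sum_cardFactors_pow_succ_le (A := primeRecipSum N + C) (by positivity) hMN (hE' N)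
        fun M' hM' => h N M' (hM'.trans hMN)).trans ?_
      rw [pow_succ]
      have h1 : primeRecipSum N + C + 1 ≤ primeRecipSum N + (C + 1 + E) := by linarith
      have h2 : primeRecipSum N + E ≤ primeRecipSum N + (C + 1 + E) := by linarith
      gcongr
    · refine (h N M hMN i (by lia)).trans ?_
      gcongr
      linarith

-- Only j = 1 is kept; each floor loses at most 1, over at most N + 1 ≤ 2N primes.
open ArithmeticFunction in
lemma le_sum_cardFactors {N : ℕ} (hN : 1 ≤ N) :
    N * (primeRecipSum N - 2) ≤ ∑ n ∈ Finset.Icc 1 N, (cardFactors n : ℝ) := by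
  have h1 := sum_mul_cardFactors (fun _ => 1) (le_refl N)
  simp only [one_mul] at h1
  rw [h1]
  have hN1 : (1 : ℝ) ≤ N := by exact_mod_cast hN
  have hcard : ((N + 1).primesBelow.card : ℝ) ≤ N + 1 := by
    have : (N + 1).primesBelow.card ≤ N + 1 :=
      (Finset.card_filter_le (Finset.range (N + 1)) Nat.Prime).trans (Finset.card_range _).le
    exact_mod_cast this
  calc N * (primeRecipSum N - 2) ≤ N * primeRecipSum N - (N + 1) := by linarith
    _ ≤ N * primeRecipSum N - ((N + 1).primesBelow.card : ℝ) := by linarith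
    _ = ∑ p ∈ (N + 1).primesBelow, ((N : ℝ) / p - 1) := by
        rw [Finset.sum_sub_distrib, primeRecipSum, Finset.mul_sum]
        simp [div_eq_mul_inv]
    _ ≤ _ := by
        refine Finset.sum_le_sum fun p hp => ?_
        have h2 : (N : ℝ) / p - 1 ≤ ∑ m ∈ Finset.Icc 1 (N / p ^ 1), (1 : ℝ) := by
          have := (Nat.lt_floor_add_one ((N : ℝ) / p)).le
          rw [Nat.floor_div_natCast, Nat.floor_natCast] at this
          simp
          linarith
        refine h2.trans (Finset.single_le_sum (f := fun j => ∑ m ∈ Finset.Icc 1 (N / p ^ j), (1 : ℝ))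
          (fun j _ => by positivity) (Finset.mem_Ico.mpr ⟨le_rfl, by lia⟩))

/-! ### Real exponents by power means -/

lemma mean_rpow_le_mean {f : ℕ → ℝ} (hf : ∀ n, 0 ≤ f n) {a : ℝ} (ha : 1 ≤ a) {N : ℕ}
    (hN : 1 ≤ N) :
    ((∑ n ∈ Finset.Icc 1 N, f n) / N) ^ a ≤ (∑ n ∈ Finset.Icc 1 N, f n ^ a) / N := by
  have hN0 : (N : ℝ) ≠ 0 := by positivity
  have h := Real.rpow_arith_mean_le_arith_mean_rpow (Finset.Icc 1 N) (fun _ => 1 / (N : ℝ)) f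
    (fun _ _ => by positivity) (by simp [hN0]) (fun n _ => hf n) ha
  rw [← Finset.mul_sum, ← Finset.mul_sum] at h
  simpa only [one_div_mul_eq_div] using h

open ArithmeticFunction in
lemma exists_sum_cardFactors_rpow_le {α : ℝ} (hα : 1 ≤ α) : ∃ C : ℝ, 0 ≤ C ∧ ∀ N : ℕ, 1 ≤ N →
    ∑ n ∈ Finset.Icc 1 N, (cardFactors n : ℝ) ^ α ≤ N * (primeRecipSum N + C) ^ α := by
  obtain ⟨C, hC, h⟩ := exists_sum_cardFactors_pow_le ⌈α⌉₊
  refine ⟨C, hC, fun N hN => ?_⟩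
  have hk : α ≤ (⌈α⌉₊ : ℝ) := Nat.le_ceil α
  have hN0 : (0 : ℝ) < N := by exact_mod_cast hN
  have hH := primeRecipSum_nonneg N
  have hα0 : 0 < α := by linarith
  set k := ⌈α⌉₊
  -- Power mean with exponent k/α ≥ 1, which turns Ω^α into the integer moment Ω^k.
  have h1 := mean_rpow_le_mean (f := fun n => (cardFactors n : ℝ) ^ α)
    (fun n => by positivity) ((one_le_div hα0).mpr hk) hN
  have h2 : ∀ x : ℝ, 0 ≤ x → (x ^ α) ^ (k / α) = x ^ k := fun x hx => by
    rw [← Real.rpow_mul hx, mul_div_cancel₀ _ hα0.ne', Real.rpow_natCast]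
  have h3 : (∑ n ∈ Finset.Icc 1 N, ((cardFactors n : ℝ) ^ α) ^ (k / α)) / N ≤
      ((primeRecipSum N + C) ^ α) ^ (k / α) := by
    rw [h2 _ (by positivity), div_le_iff₀ hN0, mul_comm]
    refine le_trans (le_of_eq ?_) (h N N le_rfl k le_rfl)
    exact Finset.sum_congr rfl fun n _ => h2 _ (by positivity)
  have h4 := (Real.rpow_le_rpow_iff (by positivity) (by positivity)
    (div_pos (hα0.trans_le hk) hα0)).mp (h1.trans h3)
  rwa [div_le_iff₀ hN0, mul_comm] at h4

open ArithmeticFunction in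
lemma le_sum_cardFactors_rpow {α : ℝ} (hα : 1 ≤ α) {N : ℕ} (hN : 1 ≤ N)
    (hH : 2 ≤ primeRecipSum N) :
    N * (primeRecipSum N - 2) ^ α ≤ ∑ n ∈ Finset.Icc 1 N, (cardFactors n : ℝ) ^ α := by
  have hN0 : (0 : ℝ) < N := by exact_mod_cast hN
  have h1 := mean_rpow_le_mean (f := fun n => (cardFactors n : ℝ)) (fun n => by positivity) hα hN
  have h2 : primeRecipSum N - 2 ≤ (∑ n ∈ Finset.Icc 1 N, (cardFactors n : ℝ)) / N := by
    rw [le_div_iff₀ hN0, mul_comm]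
    exact le_sum_cardFactors hN
  have h3 := (Real.rpow_le_rpow (by linarith) h2 (by linarith)).trans h1
  rwa [le_div_iff₀ hN0, mul_comm] at h3

/-! ### Asymptotics in log log X -/

/-- By convexity, (1 + u)^α lies below its chord on 0 ≤ u ≤ 1, of slope 2^α - 1. -/
lemma add_rpow_le {α C L : ℝ} (hα : 1 ≤ α) (hC : 0 ≤ C) (hCL : C ≤ L) (hL : 0 < L) :
    (L + C) ^ α ≤ L ^ α + 2 ^ α * C * L ^ (α - 1) := by
  have hu0 : 0 ≤ C / L := by positivity
  have hu1 : C / L ≤ 1 := (div_le_one hL).mpr hCL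
  have h1 : (1 + C / L) ^ α ≤ 1 + 2 ^ α * (C / L) := by
    have h := (convexOn_rpow hα).2 (x := 1) (y := 2) (by simp) (by simp)
      (sub_nonneg.mpr hu1) hu0 (by ring)
    simp only [smul_eq_mul, Real.one_rpow] at h
    rw [show (1 - C / L) * 1 + C / L * 2 = 1 + C / L by ring] at h
    linarith
  calc (L + C) ^ α = L ^ α * (1 + C / L) ^ α := by
        rw [← Real.mul_rpow hL.le (by positivity)]
        congr 1
        field_simp
    _ ≤ L ^ α * (1 + 2 ^ α * (C / L)) := by gcongr
    _ = _ := by rw [Real.rpow_sub_one hL.ne']; ring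

/-- Bernoulli's inequality at -C/L. -/
lemma le_sub_rpow {α C L : ℝ} (hα : 1 ≤ α) (hCL : C ≤ L) (hL : 0 < L) :
    L ^ α - α * C * L ^ (α - 1) ≤ (L - C) ^ α := by
  have hu1 : C / L ≤ 1 := (div_le_one hL).mpr hCL
  have h1 : 1 + α * (-(C / L)) ≤ (1 + -(C / L)) ^ α :=
    one_add_mul_self_le_rpow_one_add (by linarith) hα
  calc L ^ α - α * C * L ^ (α - 1) = L ^ α * (1 + α * (-(C / L))) := by
        rw [Real.rpow_sub_one hL.ne']; ring
    _ ≤ L ^ α * (1 + -(C / L)) ^ α := by gcongr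
    _ = (L - C) ^ α := by
        rw [← Real.mul_rpow hL.le (by linarith)]
        congr 1
        field_simp
        ring

lemma tendsto_loglog : Filter.Tendsto (fun X : ℝ => Real.log (Real.log X)) Filter.atTop
    Filter.atTop := Real.tendsto_log_atTop.comp Real.tendsto_log_atTop

open ArithmeticFunction in
lemma sum_cardFactors_rpow_isBigO {α : ℝ} (hα : 1 ≤ α) :
    (fun X : ℝ => (∑ n ∈ Finset.Icc 1 ⌊X⌋₊, (cardFactors n : ℝ) ^ α)
        - X * Real.log (Real.log X) ^ α)
      =O[Filter.atTop] fun X : ℝ => X * Real.log (Real.log X) ^ (α - 1) := by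
  obtain ⟨C, hC, hup⟩ := exists_sum_cardFactors_rpow_le hα
  obtain ⟨D, hD, hlow⟩ := exists_loglog_le_primeRecipSum
  -- The first term serves the upper bound, the second the lower; the final 1 absorbs the L^α lost
  -- in replacing N by X - 1.
  refine Asymptotics.IsBigO.of_bound (2 ^ α * (C + 3) + α * (D + 2) + 1) ?_
  filter_upwards [Filter.eventually_ge_atTop 3,
    -- Ensures C + 3 ≤ L and D + 2 ≤ L for the expansions, and P(N) ≥ L - D ≥ 2 for the lower bound.
    tendsto_loglog.eventually_ge_atTop (C + D + 3)] with X hX hL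
  set L := Real.log (Real.log X) with hLdef
  set N := ⌊X⌋₊
  have hL0 : 0 < L := by linarith
  have hN3 : 3 ≤ N := Nat.le_floor (by exact_mod_cast hX)
  have hN3' : (3 : ℝ) ≤ N := by exact_mod_cast hN3
  have hNX : (N : ℝ) ≤ X := Nat.floor_le (by linarith)
  have hXN : X ≤ N + 1 := (Nat.lt_floor_add_one X).le
  have hlogN : 0 < Real.log N := Real.log_pos (by linarith)
  have hlogX : 0 < Real.log X := Real.log_pos (by linarith)
  have hH1 : primeRecipSum N ≤ L + 3 := by
    have h1 : Real.log (Real.log N) ≤ L :=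
      Real.log_le_log hlogN (Real.log_le_log (by linarith) hNX)
    linarith [primeRecipSum_le hN3]
  have hH2 : L ≤ primeRecipSum N + D :=
    (Real.log_le_log hlogX (Real.log_le_log (by linarith) hXN)).trans (hlow N (by lia))
  have hLX : L ≤ X := (Real.log_le_self hlogX.le).trans (Real.log_le_self (by linarith))
  have hH0 := primeRecipSum_nonneg N
  have hLp : 0 ≤ L ^ (α - 1) := by positivity
  have hLα : L ^ α ≤ X * L ^ (α - 1) := by
    rw [Real.rpow_sub_one hL0.ne', mul_div_assoc', le_div_iff₀ hL0, mul_comm]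
    gcongr
  set S := ∑ n ∈ Finset.Icc 1 N, (cardFactors n : ℝ) ^ α
  have hS1 : S ≤ X * (L ^ α + 2 ^ α * (C + 3) * L ^ (α - 1)) := by
    refine (hup N (by lia)).trans ?_
    have h1 : (primeRecipSum N + C) ^ α ≤ (L + (C + 3)) ^ α :=
      Real.rpow_le_rpow (by positivity) (by linarith) (by linarith)
    have h2 := h1.trans (add_rpow_le hα (by linarith) (by linarith) hL0)
    exact mul_le_mul hNX h2 (by positivity) (by linarith)
  have hS2 : (X - 1) * (L - (D + 2)) ^ α ≤ S := by
    refine le_trans ?_ (le_sum_cardFactors_rpow hα (by lia) (by linarith))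
    have h1 : (L - (D + 2)) ^ α ≤ (primeRecipSum N - 2) ^ α :=
      Real.rpow_le_rpow (by linarith) (by linarith) (by linarith)
    exact mul_le_mul (by linarith) h1 (Real.rpow_nonneg (by linarith) _) (by linarith)
  have hS3 : (L - (D + 2)) ^ α ≤ L ^ α :=
    Real.rpow_le_rpow (by linarith) (by linarith) (by linarith)
  have hS4 : X * (L ^ α - α * (D + 2) * L ^ (α - 1)) ≤ X * (L - (D + 2)) ^ α :=
    mul_le_mul_of_nonneg_left (le_sub_rpow hα (by linarith) hL0) (by linarith)
  have hXL : 0 ≤ X * L ^ (α - 1) := mul_nonneg (by linarith) hLp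
  have hp1 : 0 ≤ 2 ^ α * (C + 3) * (X * L ^ (α - 1)) := by positivity
  have hp2 : 0 ≤ α * (D + 2) * (X * L ^ (α - 1)) := by positivity
  rw [Real.norm_eq_abs, Real.norm_of_nonneg hXL, abs_le]
  constructor <;> linarith

lemma rpow_sub_one_isLittleO_rpow (α : ℝ) :
    (fun x : ℝ => x ^ (α - 1)) =o[Filter.atTop] fun x : ℝ => x ^ α := by
  refine (Asymptotics.isLittleO_iff_tendsto' ?_).mpr ?_
  · filter_upwards [Filter.eventually_gt_atTop 0] with x hx h
    exact absurd h (Real.rpow_pos_of_pos hx α).ne'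
  · refine tendsto_inv_atTop_zero.congr' ?_
    filter_upwards [Filter.eventually_gt_atTop 0] with x hx
    rw [← Real.rpow_sub hx, sub_sub_cancel_left, Real.rpow_neg_one]

lemma hasAverageOrder_of_isBigO {f : ℕ → ℝ} {α : ℝ}
    (h : (fun X : ℝ => (∑ n ∈ Finset.Icc 1 ⌊X⌋₊, f n) - X * Real.log (Real.log X) ^ α)
      =O[Filter.atTop] fun X : ℝ => X * Real.log (Real.log X) ^ (α - 1)) :
    HasAverageOrder f fun X : ℝ => Real.log (Real.log X) ^ α := by
  have h1 : (fun X : ℝ => (1 / X) * (∑ n ∈ Finset.Icc 1 ⌊X⌋₊, f n) - Real.log (Real.log X) ^ α)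
      =O[Filter.atTop] fun X : ℝ => Real.log (Real.log X) ^ (α - 1) := by
    refine ((Asymptotics.isBigO_refl (fun X : ℝ => 1 / X) Filter.atTop).mul h).congr' ?_ ?_ <;>
    · filter_upwards [Filter.eventually_gt_atTop 0] with X hX
      field_simp
  have h2 : (fun X : ℝ => Real.log (Real.log X) ^ (α - 1)) =o[Filter.atTop]
      fun X : ℝ => Real.log (Real.log X) ^ α :=
    (rpow_sub_one_isLittleO_rpow α).comp_tendsto tendsto_loglog
  have h3 : Asymptotics.IsEquivalent Filter.atTop
      (fun X : ℝ => (1 / X) * ∑ n ∈ Finset.Icc 1 ⌊X⌋₊, f n)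
      (fun X : ℝ => Real.log (Real.log X) ^ α) := h1.trans_isLittleO h2
  exact h3.isTheta

theorem proposition2 (α : ℝ) (hα : 1 ≤ α) :
    ((fun X : ℝ =>
        (∑ n ∈ Finset.Icc 1 ⌊X⌋₊, (ArithmeticFunction.cardFactors n : ℝ) ^ α)
          - X * Real.log (Real.log X) ^ α)
      =O[Filter.atTop] fun X : ℝ => X * Real.log (Real.log X) ^ (α - 1)) ∧
    HasAverageOrder (fun n : ℕ => (ArithmeticFunction.cardFactors n : ℝ) ^ α)
      (fun X : ℝ => Real.log (Real.log X) ^ α) :=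
  ⟨sum_cardFactors_rpow_isBigO hα, hasAverageOrder_of_isBigO (sum_cardFactors_rpow_isBigO hα)⟩
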